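/- Let $\nu\in\mathbb{C}$ with $\operatorname{Re}\nu\ge 0$, let $k\ge 1$ be an integer, let $I\subset(0,\infty)$ be a nondegenerate interval, and let $f\in C^{2k}(I)$ be complex-valued (with one-sided derivatives at any endpoint of $I$ belonging to $I$). Write $D=\frac{d}{dx}$, let ${}_2F_1$ be the Gauss hypergeometric function, and put $$B=B_\nu=D^2+\frac{\nu}{x}D,\qquad C_\nu g=D^2g-D\Bigl(\frac{\nu}{x}\,g\Bigr).$$ For continuous $g$ on $I$, define the Bessel fractional integrals $$(B_{b-}^{\nu,k}g)(x)=\frac{1}{\Gamma(2k)}\int_x^b\Bigl(\frac{y^2-x^2}{2y}\Bigr)^{2k-1}{}_2F_1\Bigl(k+\frac{\nu-1}{2},k;2k;1-\frac{x^2}{y^2}\Bigr)g(y)\,dy\quad(x\le b),$$ $$(B_{a+}^{\nu,k}g)(x)=\frac{1}{\Gamma(2k)}\int_a^x\Bigl(\frac{x^2-y^2}{2x}\Bigr)^{2k-1}{}_2F_1\Bigl(k+\frac{\nu-1}{2},k;2k;1-\frac{y^2}{x^2}\Bigr)g(y)\,dy\quad(a\le x).$$ (1) For all $x,b\in I$ with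 $x\le b$, the integral $B_{b-}^{\nu,k}(B^kf)(x)$ converges absolutely and $$f(x)=\sum_{i=1}^{k}\Biggl\{\frac{1}{\Gamma(2i-1)}\Bigl(\frac{b^2-x^2}{2b}\Bigr)^{2i-2}{}_2F_1\Bigl(i+\frac{\nu-1}{2},i-1;2i-1;1-\frac{x^2}{b^2}\Bigr)(B^{i-1}f)(b)$$ $$-\frac{1}{\Gamma(2i)}\Bigl(\frac{b^2-x^2}{2b}\Bigr)^{2i-1}{}_2F_1\Bigl(i+\frac{\nu-1}{2},i;2i;1-\frac{x^2}{b^2}\Bigr)(DB^{i-1}f)(b)\Biggr\}+B_{b-}^{\nu,k}(B^kf)(x).$$ (2) For all $a,x\in I$ with $a\le x$, the integral $B_{a+}^{\nu,k}(C_\nu^kf)(x)$ converges absolutely and $$f(x)=\sum_{i=1}^{k}\Biggl\{\frac{1}{\Gamma(2i-1)}\Bigl(\frac{x^2-a^2}{2x}\Bigr)^{2i-2}\frac{a}{x}\;{}_2F_1\Bigl(i+\frac{\nu-1}{2},i;2i-1;1-\frac{a^2}{x^2}\Bigr)(C_\nu^{i-1}f)(a)$$ $$+\frac{1}{\Gamma(2i)}\Bigl(\frac{x^2-a^2}{2x}\Bigr)^{2i-1}{}_2F_1\Bigl(i+\frac{\nu-1}{2},i;2i;1-\frac{a^2}{x^2}\Bigr)\,a^{\nu}\,\bigl(D\,x^{-\nu}C_\nu^{i-1}f\bigr)(a)\Biggr\}+B_{a+}^{\nu,k}(C_\nu^kf)(x).$$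 -/

import Mathlib

open Set MeasureTheory

noncomputable section

/-- The Bessel operator `B_ν g = D² g + (ν / x) D g` for functions on an interval `I` of the
positive half-line. Derivatives are taken within `I`, hence one-sided at the endpoints that
belong to `I`. -/
def besselOp (ν : ℂ) (I : Set ℝ) (g : ℝ → ℂ) : ℝ → ℂ := fun x =>
  derivWithin (derivWithin g I) I x + ν / (x : ℂ) * derivWithin g I x

/-- The formal adjoint of the Bessel operator, `C_ν g = D² g - D ((ν / x) g)`, on an interval
`I` of the positive half-line. -/
def besselAdjointOp (ν : ℂ) (I : Set ℝ) (g : ℝ → ℂ) : ℝ → ℂ := fun x =>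
  derivWithin (derivWithin g I) I x - derivWithin (fun y : ℝ => ν / (y : ℂ) * g y) I x

/-- The kernel of `B_{b-}^{ν,k}`, for `0 < x ≤ y`:
`((y² - x²) / (2y))^(2k-1) ₂F₁(k + (ν-1)/2, k; 2k; 1 - x²/y²)`. -/
def besselKernelRight (ν : ℂ) (k : ℕ) (x y : ℝ) : ℂ :=
  (((y : ℂ) ^ 2 - (x : ℂ) ^ 2) / (2 * (y : ℂ))) ^ (2 * k - 1) *
    ordinaryHypergeometric ((k : ℂ) + (ν - 1) / 2) (k : ℂ) (2 * (k : ℂ))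
      (1 - (x : ℂ) ^ 2 / (y : ℂ) ^ 2)

/-- The kernel of `B_{a+}^{ν,k}`, for `0 < y ≤ x`:
`((x² - y²) / (2x))^(2k-1) ₂F₁(k + (ν-1)/2, k; 2k; 1 - y²/x²)`. -/
def besselKernelLeft (ν : ℂ) (k : ℕ) (x y : ℝ) : ℂ :=
  (((x : ℂ) ^ 2 - (y : ℂ) ^ 2) / (2 * (x : ℂ))) ^ (2 * k - 1) *
    ordinaryHypergeometric ((k : ℂ) + (ν - 1) / 2) (k : ℂ) (2 * (k : ℂ))
      (1 - (y : ℂ) ^ 2 / (x : ℂ) ^ 2)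

/-- The Bessel fractional integral `B_{b-}^{ν,k} g`, with integration over `[x, b]`. -/
def besselIntegralRight (ν : ℂ) (k : ℕ) (b : ℝ) (g : ℝ → ℂ) : ℝ → ℂ := fun x =>
  1 / Complex.Gamma (2 * (k : ℂ)) * ∫ y in x..b, besselKernelRight ν k x y * g y

/-- The Bessel fractional integral `B_{a+}^{ν,k} g`, with integration over `[a, x]`. -/
def besselIntegralLeft (ν : ℂ) (k : ℕ) (a : ℝ) (g : ℝ → ℂ) : ℝ → ℂ := fun x =>
  1 / Complex.Gamma (2 * (k : ℂ)) * ∫ y in a..x, besselKernelLeft ν k x y * g y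

end

/-!
Up to powers of the variables, every kernel in the theorem is a deformed monomial
`zⁿ / n! · ₂F₁(a, b; n + 1; z)` at `z = 1 - x² / y²`. Contiguous relations for `₂F₁`, read off from
the power series, say how these monomials differentiate. Let `L` be `B_ν` in the first formula and
`C_ν` in the second, and let `Kᵢ` be the normalised kernel of the fractional integral of order `i`
as a function of the integration variable. The differentiation rules give `L* Kᵢ₊₁ = Kᵢ` with
`K₀ = 0`, so that `Kⱼ₊₁ Lʲ⁺¹f - Kⱼ Lʲf` is the derivative of the bilinear concomitant of `Kⱼ₊₁` and
`Lʲf`. The sum over `j < k` telescopes to `Kₖ Lᵏf`, and integrating it yields the Taylor formula: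
the concomitants at the base point are its terms, while on the diagonal only the one with `j = 0`
survives, and it equals `-f(x)` for `B_ν` and `f(x)` for `C_ν`.
-/

open scoped Nat Topology

section PowerSeries

theorem hasSum_deriv_of_hasFPowerSeriesOnBall_zero {𝕜 E : Type*} [NontriviallyNormedField 𝕜]
    [NormedAddCommGroup E] [NormedSpace 𝕜 E] [CompleteSpace E] {f : 𝕜 → E}
    {p : FormalMultilinearSeries 𝕜 𝕜 E} {r : ENNReal} (hf : HasFPowerSeriesOnBall f p 0 r) {z : 𝕜}
    (hz : z ∈ Metric.eball 0 r) :
    HasSum (fun n : ℕ ↦ z ^ n • (n + 1) • p.coeff (n + 1)) (deriv f z) := by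
  simpa [FormalMultilinearSeries.apply_eq_pow_smul_coeff] using
    (hf.fderiv.hasSum hz).mapL (ContinuousLinearMap.apply 𝕜 E (1 : 𝕜))

theorem one_sub_mul_eq_of_hasSum {R : Type*} [CommRing R] [TopologicalSpace R]
    [IsTopologicalRing R] [T2Space R] {u v w : ℕ → R} {z F G H : R}
    (hF : HasSum (fun n ↦ u n * z ^ n) F) (hG : HasSum (fun n ↦ v n * z ^ n) G)
    (hH : HasSum (fun n ↦ w n * z ^ n) H) (h_zero : u 0 = v 0)
    (h_succ : ∀ n, u (n + 1) - u n = v (n + 1) + w n) :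
    (1 - z) * F = G + z * H := by
  have hF_tail : HasSum (fun n ↦ u (n + 1) * z ^ (n + 1)) (F - u 0) := by
    simpa using (hasSum_nat_add_iff' 1).2 hF
  have hG_tail : HasSum (fun n ↦ v (n + 1) * z ^ (n + 1)) (G - v 0) := by
    simpa using (hasSum_nat_add_iff' 1).2 hG
  have h_tail : F - u 0 - z * F = G - v 0 + z * H := by
    refine (hF_tail.sub (hF.mul_left z)).unique
      ((hG_tail.add (hH.mul_left z)).congr_fun fun n ↦ ?_)
    linear_combination z ^ (n + 1) * h_succ n
  linear_combination h_tail + h_zero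

end PowerSeries

section Coefficients

theorem ascPochhammer_succ_eval_eq_mul_eval_add_one {S : Type*} [CommSemiring S] (n : ℕ) (c : S) :
    (ascPochhammer S (n + 1)).eval c = c * (ascPochhammer S n).eval (c + 1) := by
  simp [ascPochhammer_succ_left, Polynomial.eval_comp]

theorem mul_ascPochhammer_eval_add_one {S : Type*} [CommSemiring S] (n : ℕ) (c : S) :
    c * (ascPochhammer S n).eval (c + 1) = (ascPochhammer S n).eval c * (c + n) := by
  rw [← ascPochhammer_succ_eval_eq_mul_eval_add_one, ascPochhammer_succ_eval]

variable {K : Type*} [Field K] (a b : K) {c : K} (n : ℕ)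

theorem mul_ordinaryHypergeometricCoefficient_eq (hc : c ≠ 0) (hcn : c + n ≠ 0) :
    c * ordinaryHypergeometricCoefficient a b c n =
      (c + n) * ordinaryHypergeometricCoefficient a b (c + 1) n := by
  have h_eval : (ascPochhammer K n).eval (c + 1) = (ascPochhammer K n).eval c * (c + n) / c :=
    eq_div_of_mul_eq hc (by rw [mul_comm, mul_ascPochhammer_eval_add_one])
  rw [ordinaryHypergeometricCoefficient, ordinaryHypergeometricCoefficient, h_eval]
  field_simp

theorem mul_ordinaryHypergeometricCoefficient_succ (hc : c ≠ 0) :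
    c * ordinaryHypergeometricCoefficient a b c (n + 1) =
      (a + n) * (b + n) / (n + 1) * ordinaryHypergeometricCoefficient a b (c + 1) n := by
  simp only [ordinaryHypergeometricCoefficient, ascPochhammer_succ_eval n a,
    ascPochhammer_succ_eval n b, ascPochhammer_succ_eval_eq_mul_eval_add_one n c,
    Nat.factorial_succ, Nat.cast_mul, Nat.cast_succ, mul_inv]
  field_simp

theorem mul_ordinaryHypergeometricCoefficient_right_sub_one_succ (hc : c ≠ 0) :
    c * ordinaryHypergeometricCoefficient a (b - 1) c (n + 1) =
      (a + n) * (b - 1) / (n + 1) * ordinaryHypergeometricCoefficient a b (c + 1) n := by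
  simp only [ordinaryHypergeometricCoefficient, ascPochhammer_succ_eval n a,
    ascPochhammer_succ_eval_eq_mul_eval_add_one n (b - 1),
    ascPochhammer_succ_eval_eq_mul_eval_add_one n c, sub_add_cancel,
    Nat.factorial_succ, Nat.cast_mul, Nat.cast_succ, mul_inv]
  field_simp

theorem mul_ordinaryHypergeometricCoefficient_sub_one_sub_one_succ (hc : c ≠ 0) :
    c * ordinaryHypergeometricCoefficient (a - 1) (b - 1) c (n + 1) =
      (a - 1) * (b - 1) / (n + 1) * ordinaryHypergeometricCoefficient a b (c + 1) n := by
  simp only [ordinaryHypergeometricCoefficient,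
    ascPochhammer_succ_eval_eq_mul_eval_add_one, sub_add_cancel,
    Nat.factorial_succ, Nat.cast_mul, Nat.cast_succ, mul_inv]
  field_simp

theorem succ_mul_ordinaryHypergeometricCoefficient_self_succ (hbn : b + n ≠ 0)
    (hn : (n : K) + 1 ≠ 0) :
    (n + 1) * ordinaryHypergeometricCoefficient a b b (n + 1) =
      (a + n) * ordinaryHypergeometricCoefficient a b b n := by
  simp only [ordinaryHypergeometricCoefficient, ascPochhammer_succ_eval,
    Nat.factorial_succ, Nat.cast_mul, Nat.cast_succ, mul_inv]
  field_simp

end Coefficients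

section Hypergeometric

variable {𝕜 : Type*} [RCLike 𝕜] (a b c : 𝕜)

theorem one_le_radius_ordinaryHypergeometricSeries :
    1 ≤ (ordinaryHypergeometricSeries 𝕜 a b c).radius := by
  by_cases h : ∃ k : ℕ, k = -a ∨ k = -b ∨ k = -c
  · obtain ⟨k, hk⟩ := h
    rw [FormalMultilinearSeries.radius_eq_top_of_forall_image_add_eq_zero _ (1 + k) fun n ↦
      ordinaryHypergeometricSeries_eq_zero_of_neg_nat a b c hk (by lia)]
    exact le_top
  · push Not at h
    exact (ordinaryHypergeometricSeries_radius_eq_one 𝕜 a b c h).ge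

theorem ordinaryHypergeometric_comm (z : 𝕜) :
    ordinaryHypergeometric a b c z = ordinaryHypergeometric b a c z := by
  rw [ordinaryHypergeometric, ordinaryHypergeometricSeries_symm, ordinaryHypergeometric]

theorem ordinaryHypergeometric_zero_right (z : 𝕜) : ordinaryHypergeometric a 0 c z = 1 := by
  rw [ordinaryHypergeometric_eq_tsum]
  dsimp only
  rw [tsum_eq_single 0 fun n hn ↦ by simp [hn]]
  simp

theorem hasFPowerSeriesOnBall_ordinaryHypergeometric :
    HasFPowerSeriesOnBall (ordinaryHypergeometric a b c) (ordinaryHypergeometricSeries 𝕜 a b c)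
      0 1 :=
  have h := one_le_radius_ordinaryHypergeometricSeries a b c
  ((ordinaryHypergeometricSeries 𝕜 a b c).hasFPowerSeriesOnBall (one_pos.trans_le h)).mono
    one_pos h

variable {c} {z : 𝕜}

theorem mem_eball_zero_one_iff : z ∈ Metric.eball (0 : 𝕜) 1 ↔ ‖z‖ < 1 := by
  rw [← ENNReal.ofReal_one, Metric.eball_ofReal, mem_ball_zero_iff]

theorem hasSum_const_mul_ordinaryHypergeometric (k : 𝕜) (hz : ‖z‖ < 1) :
    HasSum (fun n ↦ k * ordinaryHypergeometricCoefficient a b c n * z ^ n)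
      (k * ordinaryHypergeometric a b c z) := by
  simpa [ordinaryHypergeometricSeries, mul_assoc, mul_comm, mul_left_comm] using
    ((hasFPowerSeriesOnBall_ordinaryHypergeometric a b c).hasSum
      (mem_eball_zero_one_iff.2 hz)).mul_left k

theorem differentiableAt_ordinaryHypergeometric (hz : ‖z‖ < 1) :
    DifferentiableAt 𝕜 (ordinaryHypergeometric a b c) z :=
  ((hasFPowerSeriesOnBall_ordinaryHypergeometric a b c).analyticAt_of_mem
    (mem_eball_zero_one_iff.2 hz)).differentiableAt

theorem hasSum_deriv_ordinaryHypergeometric (hz : ‖z‖ < 1) :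
    HasSum (fun n : ℕ ↦ (n + 1) * ordinaryHypergeometricCoefficient a b c (n + 1) * z ^ n)
      (deriv (ordinaryHypergeometric a b c) z) := by
  simpa [ordinaryHypergeometricSeries, mul_comm] using
    hasSum_deriv_of_hasFPowerSeriesOnBall_zero (hasFPowerSeriesOnBall_ordinaryHypergeometric a b c)
      (mem_eball_zero_one_iff.2 hz)

theorem mul_deriv_ordinaryHypergeometric_add_one (hc : ∀ m : ℕ, c + m ≠ 0) (hz : ‖z‖ < 1) :
    z * deriv (ordinaryHypergeometric a b (c + 1)) z =
      c * (ordinaryHypergeometric a b c z - ordinaryHypergeometric a b (c + 1) z) := by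
  have h_tail : HasSum (fun n ↦ c * ordinaryHypergeometricCoefficient a b c (n + 1) * z ^ (n + 1) -
      c * ordinaryHypergeometricCoefficient a b (c + 1) (n + 1) * z ^ (n + 1))
      (c * ordinaryHypergeometric a b c z - c * ordinaryHypergeometric a b (c + 1) z) := by
    simpa [ordinaryHypergeometricCoefficient] using (hasSum_nat_add_iff' 1).2 <|
      (hasSum_const_mul_ordinaryHypergeometric a b c hz (c := c)).sub
        (hasSum_const_mul_ordinaryHypergeometric a b c hz (c := c + 1))
  have hc_zero : c ≠ 0 := by simpa using hc 0
  rw [mul_sub]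
  refine ((hasSum_deriv_ordinaryHypergeometric a b hz).mul_left z).unique
    (h_tail.congr_fun fun n ↦ ?_)
  rw [mul_ordinaryHypergeometricCoefficient_eq a b (n + 1) hc_zero (hc _)]
  push_cast
  ring

theorem one_sub_mul_ordinaryHypergeometric_eq_right_sub_one (hc : ∀ m : ℕ, c + m ≠ 0)
    (hz : ‖z‖ < 1) :
    c * ((1 - z) * ordinaryHypergeometric a b c z) =
      c * ordinaryHypergeometric a (b - 1) c z +
        (a - c) * z * ordinaryHypergeometric a b (c + 1) z := by
  have hc_zero : c ≠ 0 := by simpa using hc 0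
  have hF := hasSum_const_mul_ordinaryHypergeometric a b (c := c) c hz
  have hG := hasSum_const_mul_ordinaryHypergeometric a (b - 1) (c := c) c hz
  have hH := hasSum_const_mul_ordinaryHypergeometric a b (c := c + 1) (a - c) hz
  have h_coeff (n : ℕ) : c * ordinaryHypergeometricCoefficient a b c (n + 1) -
      c * ordinaryHypergeometricCoefficient a b c n =
        c * ordinaryHypergeometricCoefficient a (b - 1) c (n + 1) +
          (a - c) * ordinaryHypergeometricCoefficient a b (c + 1) n := by
    rw [mul_ordinaryHypergeometricCoefficient_succ a b n hc_zero,
      mul_ordinaryHypergeometricCoefficient_right_sub_one_succ a b n hc_zero,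
      mul_ordinaryHypergeometricCoefficient_eq a b n hc_zero (hc n)]
    have hn : (n : 𝕜) + 1 ≠ 0 := n.cast_add_one_ne_zero
    field_simp
    ring
  linear_combination one_sub_mul_eq_of_hasSum hF hG hH (by simp) h_coeff

theorem one_sub_mul_ordinaryHypergeometric_eq_sub_one_sub_one (hc : ∀ m : ℕ, c + m ≠ 0)
    (hz : ‖z‖ < 1) :
    c * ((1 - z) * ordinaryHypergeometric a b c z) =
      c * ordinaryHypergeometric (a - 1) (b - 1) c z +
        (a + b - 1 - c) * z * ordinaryHypergeometric a b (c + 1) z := by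
  have hc_zero : c ≠ 0 := by simpa using hc 0
  have hF := hasSum_const_mul_ordinaryHypergeometric a b (c := c) c hz
  have hG := hasSum_const_mul_ordinaryHypergeometric (a - 1) (b - 1) (c := c) c hz
  have hH := hasSum_const_mul_ordinaryHypergeometric a b (c := c + 1) (a + b - 1 - c) hz
  have h_coeff (n : ℕ) : c * ordinaryHypergeometricCoefficient a b c (n + 1) -
      c * ordinaryHypergeometricCoefficient a b c n =
        c * ordinaryHypergeometricCoefficient (a - 1) (b - 1) c (n + 1) +
          (a + b - 1 - c) * ordinaryHypergeometricCoefficient a b (c + 1) n := by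
    rw [mul_ordinaryHypergeometricCoefficient_succ a b n hc_zero,
      mul_ordinaryHypergeometricCoefficient_sub_one_sub_one_succ a b n hc_zero,
      mul_ordinaryHypergeometricCoefficient_eq a b n hc_zero (hc n)]
    have hn : (n : 𝕜) + 1 ≠ 0 := n.cast_add_one_ne_zero
    field_simp
    ring
  linear_combination one_sub_mul_eq_of_hasSum hF hG hH (by simp) h_coeff

theorem one_sub_mul_deriv_ordinaryHypergeometric_self (hb : ∀ m : ℕ, b + m ≠ 0) (hz : ‖z‖ < 1) :
    (1 - z) * deriv (ordinaryHypergeometric a b b) z = a * ordinaryHypergeometric a b b z := by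
  have hF := hasSum_deriv_ordinaryHypergeometric a b hz (c := b)
  have hG := hasSum_const_mul_ordinaryHypergeometric a b (c := b) a hz
  have h_coeff (n : ℕ) := succ_mul_ordinaryHypergeometricCoefficient_self_succ a b n (hb n)
    n.cast_add_one_ne_zero
  have hH : HasSum (fun n ↦ (0 : 𝕜) * z ^ n) 0 := by simp
  have h_zero : ((0 : ℕ) + 1) * ordinaryHypergeometricCoefficient a b b (0 + 1) =
      a * ordinaryHypergeometricCoefficient a b b 0 := by
    rw [h_coeff 0, Nat.cast_zero, add_zero]
  have h_step (n : ℕ) : ((n + 1 : ℕ) + 1) * ordinaryHypergeometricCoefficient a b b (n + 1 + 1) -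
      (n + 1) * ordinaryHypergeometricCoefficient a b b (n + 1) =
        a * ordinaryHypergeometricCoefficient a b b (n + 1) + 0 := by
    rw [h_coeff (n + 1)]
    push_cast
    ring
  simpa using one_sub_mul_eq_of_hasSum hF hG hH h_zero h_step

end Hypergeometric

section HypergeometricMonomial

variable {𝕜 : Type*} [RCLike 𝕜]

/-- The deformation `zⁿ / n! · ₂F₁(a, b; n + 1; z)` of the monomial `zⁿ / n!`. The lower parameter
is tied to the degree so that differentiation lowers the degree and keeps `a` and `b`. -/
noncomputable def hypergeometricMonomial (a b : 𝕜) (n : ℕ) (z : 𝕜) : 𝕜 :=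
  z ^ n / n ! * ordinaryHypergeometric a b (n + 1 : 𝕜) z

variable (a b : 𝕜) (n : ℕ) {z : 𝕜}

theorem natCast_add_one_add_natCast_ne_zero (m : ℕ) : (n + 1 + m : 𝕜) ≠ 0 := by
  rw [add_right_comm]
  exact_mod_cast (n + m).succ_ne_zero

theorem hasDerivAt_hypergeometricMonomial_succ (hz : ‖z‖ < 1) :
    HasDerivAt (hypergeometricMonomial a b (n + 1)) (hypergeometricMonomial a b n z) z := by
  have h_lower := mul_deriv_ordinaryHypergeometric_add_one a b
    (natCast_add_one_add_natCast_ne_zero (𝕜 := 𝕜) n) hz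
  have hF := (differentiableAt_ordinaryHypergeometric a b (c := (n + 1 : 𝕜) + 1) hz).hasDerivAt
  refine (((hasDerivAt_pow (n + 1) z).div_const ((n + 1)! : 𝕜)).mul
    (by exact_mod_cast hF)).congr_deriv ?_
  have hn : (n : 𝕜) + 1 ≠ 0 := n.cast_add_one_ne_zero
  have hn_fact : (n ! : 𝕜) ≠ 0 := by exact_mod_cast n.factorial_ne_zero
  simp only [hypergeometricMonomial, Nat.factorial_succ]
  push_cast
  field_simp
  linear_combination z ^ n * h_lower

theorem one_sub_mul_hypergeometricMonomial_eq_right_sub_one (hz : ‖z‖ < 1) :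
    (1 - z) * hypergeometricMonomial a b n z =
      hypergeometricMonomial a (b - 1) n z +
        (a - n - 1) * hypergeometricMonomial a b (n + 1) z := by
  have h_contiguous := one_sub_mul_ordinaryHypergeometric_eq_right_sub_one a b
    (natCast_add_one_add_natCast_ne_zero (𝕜 := 𝕜) n) hz
  have hn : (n : 𝕜) + 1 ≠ 0 := n.cast_add_one_ne_zero
  have hn_fact : (n ! : 𝕜) ≠ 0 := by exact_mod_cast n.factorial_ne_zero
  simp only [hypergeometricMonomial, Nat.factorial_succ]
  push_cast
  field_simp
  linear_combination z ^ n * h_contiguous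

theorem one_sub_mul_hypergeometricMonomial_eq_sub_one_sub_one (hz : ‖z‖ < 1) :
    (1 - z) * hypergeometricMonomial a b n z =
      hypergeometricMonomial (a - 1) (b - 1) n z +
        (a + b - n - 2) * hypergeometricMonomial a b (n + 1) z := by
  have h_contiguous := one_sub_mul_ordinaryHypergeometric_eq_sub_one_sub_one a b
    (natCast_add_one_add_natCast_ne_zero (𝕜 := 𝕜) n) hz
  have hn : (n : 𝕜) + 1 ≠ 0 := n.cast_add_one_ne_zero
  have hn_fact : (n ! : 𝕜) ≠ 0 := by exact_mod_cast n.factorial_ne_zero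
  simp only [hypergeometricMonomial, Nat.factorial_succ]
  push_cast
  field_simp
  linear_combination z ^ n * h_contiguous

theorem hasDerivAt_hypergeometricMonomial_one_zero (hz : ‖z‖ < 1) :
    HasDerivAt (hypergeometricMonomial a 1 0) (a / (1 - z) * hypergeometricMonomial a 1 0 z) z := by
  have h_deriv := one_sub_mul_deriv_ordinaryHypergeometric_self a (b := (1 : 𝕜))
    (by simpa using natCast_add_one_add_natCast_ne_zero (𝕜 := 𝕜) 0) hz
  have hz_ne : 1 - z ≠ 0 := sub_ne_zero.2 fun h ↦ by simp [← h] at hz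
  have h_eq : hypergeometricMonomial a 1 0 = ordinaryHypergeometric a 1 1 := by
    ext w
    simp [hypergeometricMonomial]
  rw [h_eq]
  refine (differentiableAt_ordinaryHypergeometric a 1 hz).hasDerivAt.congr_deriv ?_
  rw [div_mul_eq_mul_div, ← h_deriv, mul_div_cancel_left₀ _ hz_ne]

end HypergeometricMonomial

section BesselMonomial

/-- The deformation `((y² - x²) / (2y))ⁿ / n! · ₂F₁(a, b; n + 1; 1 - x² / y²)` of the Taylor
monomial `(y - x)ⁿ / n!`; all the kernels of the Bessel calculus are instances of it. It is meant
for `0 < x ≤ y`. -/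
noncomputable def besselMonomial (a b : ℂ) (n : ℕ) (x y : ℝ) : ℂ :=
  (((y : ℂ) ^ 2 - (x : ℂ) ^ 2) / (2 * (y : ℂ))) ^ n / n ! *
    ordinaryHypergeometric a b (n + 1 : ℂ) (1 - (x : ℂ) ^ 2 / (y : ℂ) ^ 2)

theorem besselMonomial_comm (a b : ℂ) (n : ℕ) (x y : ℝ) :
    besselMonomial a b n x y = besselMonomial b a n x y := by
  rw [besselMonomial, ordinaryHypergeometric_comm, besselMonomial]

theorem besselMonomial_zero_self (a b : ℂ) {x : ℝ} (hx : x ≠ 0) : besselMonomial a b 0 x x = 1 := by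
  simp [besselMonomial, hx]

theorem besselMonomial_succ_self (a b : ℂ) (n : ℕ) (x : ℝ) :
    besselMonomial a b (n + 1) x x = 0 := by
  simp [besselMonomial]

theorem besselMonomial_zero_right_zero (a : ℂ) (x y : ℝ) : besselMonomial a 0 0 x y = 1 := by
  simp [besselMonomial, ordinaryHypergeometric_zero_right]

variable (a b : ℂ) (n : ℕ) {x y : ℝ}

theorem besselMonomial_eq_mul_hypergeometricMonomial (hy : y ≠ 0) :
    besselMonomial a b n x y =
      ((y : ℂ) / 2) ^ n * hypergeometricMonomial a b n (1 - (x : ℂ) ^ 2 / (y : ℂ) ^ 2) := by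
  have h_base : ((y : ℂ) ^ 2 - (x : ℂ) ^ 2) / (2 * (y : ℂ)) =
      (y : ℂ) / 2 * (1 - (x : ℂ) ^ 2 / (y : ℂ) ^ 2) := by
    have : (y : ℂ) ≠ 0 := by exact_mod_cast hy
    field_simp
  rw [besselMonomial, h_base, hypergeometricMonomial, mul_pow]
  ring

theorem hasDerivAt_ofReal (x : ℝ) : HasDerivAt ((↑) : ℝ → ℂ) 1 x :=
  (hasDerivAt_id (x : ℂ)).comp_ofReal

theorem norm_one_sub_sq_div_sq_lt_one (hx : 0 < x) (hxy : x ≤ y) :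
    ‖1 - (x : ℂ) ^ 2 / (y : ℂ) ^ 2‖ < 1 := by
  have hy : 0 < y := hx.trans_le hxy
  have h_pos : 0 < x ^ 2 / y ^ 2 := by positivity
  have h_le : x ^ 2 / y ^ 2 ≤ 1 := div_le_one_of_le₀ (by gcongr) (by positivity)
  rw [show 1 - (x : ℂ) ^ 2 / (y : ℂ) ^ 2 = ((1 - x ^ 2 / y ^ 2 : ℝ) : ℂ) by push_cast; rfl,
    Complex.norm_real, Real.norm_of_nonneg (by linarith)]
  linarith

theorem hasDerivAt_one_sub_sq_div_sq_left :
    HasDerivAt (fun x : ℝ ↦ 1 - (x : ℂ) ^ 2 / (y : ℂ) ^ 2) (-(2 * x / (y : ℂ) ^ 2)) x := by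
  simpa using (((hasDerivAt_ofReal x).pow 2).div_const ((y : ℂ) ^ 2)).const_sub 1

theorem hasDerivAt_one_sub_sq_div_sq_right (hy : y ≠ 0) :
    HasDerivAt (fun y : ℝ ↦ 1 - (x : ℂ) ^ 2 / (y : ℂ) ^ 2) (2 * (x : ℂ) ^ 2 / (y : ℂ) ^ 3) y := by
  have hy' : (y : ℂ) ≠ 0 := by exact_mod_cast hy
  refine (((hasDerivAt_const y ((x : ℂ) ^ 2)).div ((hasDerivAt_ofReal y).pow 2)
    (pow_ne_zero 2 hy')).const_sub 1).congr_deriv ?_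
  simp only [Pi.pow_apply]
  field_simp
  ring

theorem hasDerivAt_besselMonomial_succ_right (hx : 0 < x) (hxy : x ≤ y) :
    HasDerivAt (fun y ↦ besselMonomial a b (n + 1) x y)
      (besselMonomial a (b - 1) n x y +
        (2 * a - n - 1) / y * besselMonomial a b (n + 1) x y) y := by
  have hy : y ≠ 0 := (hx.trans_le hxy).ne'
  have hy' : (y : ℂ) ≠ 0 := by exact_mod_cast hy
  have hz := norm_one_sub_sq_div_sq_lt_one hx hxy
  have h_contiguous := one_sub_mul_hypergeometricMonomial_eq_right_sub_one a b n hz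
  have h_pow : HasDerivAt (fun y : ℝ ↦ ((y : ℂ) / 2) ^ (n + 1))
      ((n + 1) / 2 * ((y : ℂ) / 2) ^ n) y :=
    (((hasDerivAt_ofReal y).div_const 2).pow (n + 1)).congr_deriv (by
      rw [Nat.add_sub_cancel]; push_cast; ring)
  have h_mul := h_pow.mul ((hasDerivAt_hypergeometricMonomial_succ a b n hz).comp y
    (hasDerivAt_one_sub_sq_div_sq_right hy))
  refine (h_mul.congr_of_eventuallyEq ?_).congr_deriv ?_
  · filter_upwards [eventually_ne_nhds hy] with t ht
    exact besselMonomial_eq_mul_hypergeometricMonomial a b (n + 1) ht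
  · simp only [besselMonomial_eq_mul_hypergeometricMonomial _ _ _ hy, Function.comp_apply]
    set z : ℂ := 1 - (x : ℂ) ^ 2 / (y : ℂ) ^ 2 with hz_def
    have h_sq : (x : ℂ) ^ 2 / (y : ℂ) ^ 3 = (1 - z) / y := by rw [hz_def]; field_simp; ring
    rw [mul_div_assoc, h_sq, pow_succ]
    field_simp
    linear_combination 2 * ((y : ℂ) / 2) ^ n * h_contiguous

theorem hasDerivAt_besselMonomial_succ_left (hx : 0 < x) (hxy : x ≤ y) :
    HasDerivAt (fun x ↦ besselMonomial a b (n + 1) x y)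
      (-(x / y * besselMonomial a b n x y)) x := by
  have hy : y ≠ 0 := (hx.trans_le hxy).ne'
  have hz := norm_one_sub_sq_div_sq_lt_one hx hxy
  simp only [besselMonomial_eq_mul_hypergeometricMonomial _ _ _ hy]
  refine (((hasDerivAt_hypergeometricMonomial_succ a b n hz).comp x
    hasDerivAt_one_sub_sq_div_sq_left).const_mul (((y : ℂ) / 2) ^ (n + 1))).congr_deriv ?_
  rw [pow_succ]
  field_simp

theorem hasDerivAt_div_mul_besselMonomial_succ_left (hx : 0 < x) (hxy : x ≤ y) :
    HasDerivAt (fun x : ℝ ↦ x / y * besselMonomial a b (n + 1) x y)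
      (-besselMonomial (a - 1) (b - 1) n x y +
        (2 * n + 5 - 2 * a - 2 * b) / x * (x / y * besselMonomial a b (n + 1) x y)) x := by
  have hy : y ≠ 0 := (hx.trans_le hxy).ne'
  have hx' : (x : ℂ) ≠ 0 := by exact_mod_cast hx.ne'
  have hy' : (y : ℂ) ≠ 0 := by exact_mod_cast hy
  have h_contiguous := one_sub_mul_hypergeometricMonomial_eq_sub_one_sub_one a b n
    (norm_one_sub_sq_div_sq_lt_one hx hxy)
  refine (((hasDerivAt_ofReal x).div_const (y : ℂ)).mul
    (hasDerivAt_besselMonomial_succ_left a b n hx hxy)).congr_deriv ?_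
  simp only [besselMonomial_eq_mul_hypergeometricMonomial _ _ _ hy]
  rw [sub_sub_cancel] at h_contiguous
  rw [pow_succ]
  field_simp at h_contiguous ⊢
  linear_combination -2 * ((y : ℂ) / 2) ^ n * h_contiguous

theorem hasDerivAt_div_mul_besselMonomial_one_zero_left (hx : 0 < x) (hxy : x ≤ y) :
    HasDerivAt (fun x : ℝ ↦ x / y * besselMonomial a 1 0 x y)
      ((1 - 2 * a) / x * (x / y * besselMonomial a 1 0 x y)) x := by
  have hy : y ≠ 0 := (hx.trans_le hxy).ne'
  have hx' : (x : ℂ) ≠ 0 := by exact_mod_cast hx.ne'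
  have hy' : (y : ℂ) ≠ 0 := by exact_mod_cast hy
  have hz := norm_one_sub_sq_div_sq_lt_one hx hxy
  simp only [besselMonomial_eq_mul_hypergeometricMonomial _ _ _ hy, pow_zero, one_mul]
  refine (((hasDerivAt_ofReal x).div_const (y : ℂ)).mul
    ((hasDerivAt_hypergeometricMonomial_one_zero a hz).comp x
      hasDerivAt_one_sub_sq_div_sq_left)).congr_deriv ?_
  simp only [sub_sub_cancel, Function.comp_apply]
  field_simp
  ring

end BesselMonomial

section Kernels

/-- The kernel of `B_{b-}^{ν,i}` including its factor `1 / Γ(2i)`, for `0 < x ≤ y`; it is also the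
coefficient of `D B^{i-1} f` in the Taylor formula. Since `1 / Γ(0)` is read as `0`, it vanishes for
`i = 0`. -/
noncomputable def besselRiesz (ν : ℂ) (i : ℕ) (x y : ℝ) : ℂ :=
  1 / Complex.Gamma (2 * (i : ℂ)) *
    (((y : ℂ) ^ 2 - (x : ℂ) ^ 2) / (2 * (y : ℂ))) ^ (2 * i - 1) *
    ordinaryHypergeometric ((i : ℂ) + (ν - 1) / 2) (i : ℂ) (2 * (i : ℂ))
      (1 - (x : ℂ) ^ 2 / (y : ℂ) ^ 2)

/-- The coefficient of `B^{i-1} f` in the right Taylor formula, for `0 < x ≤ y` and `1 ≤ i`. -/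
noncomputable def besselTaylorRight (ν : ℂ) (i : ℕ) (x y : ℝ) : ℂ :=
  1 / Complex.Gamma (2 * (i : ℂ) - 1) *
    (((y : ℂ) ^ 2 - (x : ℂ) ^ 2) / (2 * (y : ℂ))) ^ (2 * i - 2) *
    ordinaryHypergeometric ((i : ℂ) + (ν - 1) / 2) ((i : ℂ) - 1) (2 * (i : ℂ) - 1)
      (1 - (x : ℂ) ^ 2 / (y : ℂ) ^ 2)

/-- The coefficient of `C_ν^{i-1} f` in the left Taylor formula, for `0 < x ≤ y` and `1 ≤ i`. The
base point is the smaller argument `x`. -/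
noncomputable def besselTaylorLeft (ν : ℂ) (i : ℕ) (x y : ℝ) : ℂ :=
  1 / Complex.Gamma (2 * (i : ℂ) - 1) *
    (((y : ℂ) ^ 2 - (x : ℂ) ^ 2) / (2 * (y : ℂ))) ^ (2 * i - 2) *
    ((x : ℂ) / (y : ℂ)) *
    ordinaryHypergeometric ((i : ℂ) + (ν - 1) / 2) (i : ℂ) (2 * (i : ℂ) - 1)
      (1 - (x : ℂ) ^ 2 / (y : ℂ) ^ 2)

variable (ν : ℂ) (j : ℕ) {x y : ℝ}

theorem besselRiesz_zero (x y : ℝ) : besselRiesz ν 0 x y = 0 := by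
  simp [besselRiesz]

theorem besselRiesz_succ (x y : ℝ) :
    besselRiesz ν (j + 1) x y =
      besselMonomial ((j + 1 : ℕ) + (ν - 1) / 2) (j + 1) (2 * j + 1) x y := by
  have h_lower : 2 * ((j + 1 : ℕ) : ℂ) = (2 * j + 1 : ℕ) + 1 := by push_cast; ring
  rw [besselRiesz, besselMonomial, h_lower, Complex.Gamma_nat_eq_factorial,
    show 2 * (j + 1) - 1 = 2 * j + 1 by lia]
  push_cast
  ring_nf

theorem besselTaylorRight_succ (x y : ℝ) :
    besselTaylorRight ν (j + 1) x y =
      besselMonomial ((j + 1 : ℕ) + (ν - 1) / 2) j (2 * j) x y := by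
  have h_lower : 2 * ((j + 1 : ℕ) : ℂ) - 1 = (2 * j : ℕ) + 1 := by push_cast; ring
  rw [besselTaylorRight, besselMonomial, h_lower, Complex.Gamma_nat_eq_factorial,
    show 2 * (j + 1) - 2 = 2 * j by lia]
  push_cast
  ring_nf

theorem besselTaylorLeft_succ (x y : ℝ) :
    besselTaylorLeft ν (j + 1) x y =
      x / y * besselMonomial ((j + 1 : ℕ) + (ν - 1) / 2) (j + 1) (2 * j) x y := by
  have h_lower : 2 * ((j + 1 : ℕ) : ℂ) - 1 = (2 * j : ℕ) + 1 := by push_cast; ring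
  rw [besselTaylorLeft, besselMonomial, h_lower, Complex.Gamma_nat_eq_factorial,
    show 2 * (j + 1) - 2 = 2 * j by lia]
  push_cast
  ring_nf

theorem besselRiesz_self (x : ℝ) : besselRiesz ν (j + 1) x x = 0 := by
  rw [besselRiesz_succ, besselMonomial_succ_self]

theorem besselTaylorRight_one (x y : ℝ) : besselTaylorRight ν 1 x y = 1 := by
  simpa [besselMonomial_zero_right_zero] using besselTaylorRight_succ ν 0 x y

theorem besselTaylorRight_add_two_self (x : ℝ) : besselTaylorRight ν (j + 1 + 1) x x = 0 := by
  rw [besselTaylorRight_succ, mul_add_one, besselMonomial_succ_self]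

theorem besselTaylorLeft_one_self (hx : x ≠ 0) : besselTaylorLeft ν 1 x x = 1 := by
  simpa [besselMonomial_zero_self _ _ hx, hx] using besselTaylorLeft_succ ν 0 x x

theorem besselTaylorLeft_add_two_self (x : ℝ) : besselTaylorLeft ν (j + 1 + 1) x x = 0 := by
  rw [besselTaylorLeft_succ, mul_add_one, besselMonomial_succ_self, mul_zero]

theorem hasDerivAt_besselRiesz_right (hx : 0 < x) (hxy : x ≤ y) :
    HasDerivAt (besselRiesz ν (j + 1) x)
      (besselTaylorRight ν (j + 1) x y + ν / y * besselRiesz ν (j + 1) x y) y := by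
  have h_deriv := hasDerivAt_besselMonomial_succ_right ((j + 1 : ℕ) + (ν - 1) / 2) (j + 1) (2 * j)
    hx hxy
  rw [funext (besselRiesz_succ ν j x), besselTaylorRight_succ]
  refine h_deriv.congr_deriv ?_
  push_cast
  ring_nf

theorem hasDerivAt_besselTaylorRight (hx : 0 < x) (hxy : x ≤ y) :
    HasDerivAt (besselTaylorRight ν (j + 1) x) (besselRiesz ν j x y) y := by
  cases j with
  | zero =>
    rw [funext (besselTaylorRight_one ν x), besselRiesz_zero]
    exact hasDerivAt_const y 1
  | succ j =>
    have h_deriv := hasDerivAt_besselMonomial_succ_right (j + 1 : ℕ)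
      ((j + 1 + 1 : ℕ) + (ν - 1) / 2) (2 * j + 1) hx hxy
    have h_swap : besselTaylorRight ν (j + 1 + 1) x = fun y ↦
        besselMonomial (j + 1 : ℕ) ((j + 1 + 1 : ℕ) + (ν - 1) / 2) (2 * j + 1 + 1) x y :=
      funext fun y ↦ (besselTaylorRight_succ ν (j + 1) x y).trans (besselMonomial_comm _ _ _ x y)
    rw [h_swap, besselRiesz_succ, besselMonomial_comm]
    refine h_deriv.congr_deriv ?_
    push_cast
    ring_nf

theorem hasDerivAt_besselRiesz_left (hx : 0 < x) (hxy : x ≤ y) :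
    HasDerivAt (fun x ↦ besselRiesz ν (j + 1) x y) (-besselTaylorLeft ν (j + 1) x y) x := by
  simp only [besselRiesz_succ, besselTaylorLeft_succ]
  exact hasDerivAt_besselMonomial_succ_left _ _ (2 * j) hx hxy

theorem hasDerivAt_besselTaylorLeft (hx : 0 < x) (hxy : x ≤ y) :
    HasDerivAt (fun x ↦ besselTaylorLeft ν (j + 1) x y)
      (-besselRiesz ν j x y - ν / x * besselTaylorLeft ν (j + 1) x y) x := by
  simp only [besselTaylorLeft_succ]
  cases j with
  | zero =>
    have h_deriv := hasDerivAt_div_mul_besselMonomial_one_zero_left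
      ((0 + 1 : ℕ) + (ν - 1) / 2) hx hxy
    rw [besselRiesz_zero]
    simp only [Nat.cast_zero, zero_add, mul_zero]
    refine h_deriv.congr_deriv ?_
    push_cast
    ring
  | succ j =>
    have h_deriv := hasDerivAt_div_mul_besselMonomial_succ_left ((j + 1 + 1 : ℕ) + (ν - 1) / 2)
      (j + 1 + 1) (2 * j + 1) hx hxy
    rw [besselRiesz_succ]
    convert! h_deriv using 1
    · push_cast; rfl
    · push_cast
      ring_nf

end Kernels

section Telescoping

theorem sum_Icc_one_eq_sum_range {M : Type*} [AddCommMonoid M] (F : ℕ → M) (k : ℕ) :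
    ∑ i ∈ Finset.Icc 1 k, F i = ∑ j ∈ Finset.range k, F (j + 1) := by
  rw [Finset.range_eq_Ico, Finset.sum_Ico_add' F 0 k 1]
  rfl

theorem integral_sub_eq_sum_of_hasDerivAt {E : Type*} [NormedAddCommGroup E] [NormedSpace ℝ E]
    [CompleteSpace E] {a b : ℝ} (hab : a ≤ b) {k : ℕ} {W u : ℕ → ℝ → E}
    (h_cont : ∀ j < k, ContinuousOn (W j) (Icc a b))
    (h_deriv : ∀ j < k, ∀ y ∈ Ioo a b, HasDerivAt (W j) (u (j + 1) y - u j y) y)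
    (h_int : IntervalIntegrable (fun y ↦ u k y - u 0 y) volume a b) :
    ∫ y in a..b, (u k y - u 0 y) = ∑ j ∈ Finset.range k, (W j b - W j a) := by
  rw [Finset.sum_sub_distrib]
  refine intervalIntegral.integral_eq_sub_of_hasDerivAt_of_le hab
    (continuousOn_finsetSum _ fun j hj ↦ h_cont j (Finset.mem_range.1 hj)) (fun y hy ↦ ?_) h_int
  rw [← Finset.sum_range_sub (u · y)]
  exact HasDerivAt.fun_sum fun j hj ↦ h_deriv j (Finset.mem_range.1 hj) y hy

end Telescoping

section Operators

variable {I : Set ℝ} {ν : ℂ} {g : ℝ → ℂ}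

theorem uniqueDiffOn_of_ordConnected_nontrivial (hI : I.OrdConnected) (hInt : I.Nontrivial) :
    UniqueDiffOn ℝ I := by
  obtain ⟨a, ha, b, hb, hab⟩ := hInt.exists_lt
  have h_interior : Ioo a b ⊆ interior I :=
    interior_maximal (Ioo_subset_Icc_self.trans (hI.out ha hb)) isOpen_Ioo
  exact uniqueDiffOn_convex hI.convex ((nonempty_Ioo.2 hab).mono h_interior)

theorem contDiffOn_const_div_ofReal (hIpos : I ⊆ Ioi 0) {n : WithTop ℕ∞} :
    ContDiffOn ℝ n (fun y : ℝ ↦ ν / (y : ℂ)) I :=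
  contDiffOn_const.mul <| Complex.ofRealCLM.contDiff.contDiffOn.inv fun _ hy ↦
    Complex.ofReal_ne_zero.2 (hIpos hy).ne'

theorem contDiffOn_besselOp (hI : UniqueDiffOn ℝ I) (hIpos : I ⊆ Ioi 0) {n : ℕ}
    (hg : ContDiffOn ℝ (n + 2 : ℕ) g I) : ContDiffOn ℝ n (besselOp ν I g) I := by
  have h_deriv : ContDiffOn ℝ (n + 1 : ℕ) (derivWithin g I) I := hg.derivWithin hI le_rfl
  exact (h_deriv.derivWithin hI le_rfl).add
    ((contDiffOn_const_div_ofReal hIpos).mul (h_deriv.of_le (by norm_cast; lia)))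

theorem contDiffOn_besselAdjointOp (hI : UniqueDiffOn ℝ I) (hIpos : I ⊆ Ioi 0) {n : ℕ}
    (hg : ContDiffOn ℝ (n + 2 : ℕ) g I) : ContDiffOn ℝ n (besselAdjointOp ν I g) I := by
  have h_deriv : ContDiffOn ℝ (n + 1 : ℕ) (derivWithin g I) I := hg.derivWithin hI le_rfl
  exact (h_deriv.derivWithin hI le_rfl).sub
    (((contDiffOn_const_div_ofReal hIpos).mul hg).derivWithin hI (by norm_cast; lia))

theorem contDiffOn_iterate_of_order_two {T : (ℝ → ℂ) → ℝ → ℂ}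
    (hT : ∀ {n : ℕ} {g : ℝ → ℂ}, ContDiffOn ℝ (n + 2 : ℕ) g I → ContDiffOn ℝ n (T g) I) (j n : ℕ)
    (hg : ContDiffOn ℝ (n + 2 * j : ℕ) g I) : ContDiffOn ℝ n (T^[j] g) I := by
  induction j generalizing n with
  | zero => simpa using hg
  | succ j ih =>
    rw [Function.iterate_succ_apply']
    exact hT (ih (n + 2) (by convert hg using 2; ring))

theorem cpow_mul_derivWithin_cpow_neg_mul {a : ℝ} (ha : 0 < a) (hI : UniqueDiffWithinAt ℝ I a)
    (hg : DifferentiableWithinAt ℝ g I a) :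
    (a : ℂ) ^ ν * derivWithin (fun y : ℝ ↦ (y : ℂ) ^ (-ν) * g y) I a =
      derivWithin g I a - ν / a * g a := by
  have ha_ne : (a : ℂ) ≠ 0 := Complex.ofReal_ne_zero.2 ha.ne'
  have h_pow_ne : (a : ℂ) ^ ν ≠ 0 := by simp [Complex.cpow_eq_zero_iff, ha_ne]
  have h_pow : HasDerivAt (fun y : ℝ ↦ (y : ℂ) ^ (-ν)) (-ν * (a : ℂ) ^ (-ν - 1) * 1) a :=
    ((hasDerivAt_id (a : ℂ)).cpow_const (Or.inl (by simpa using ha))).comp_ofReal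
  rw [(h_pow.hasDerivWithinAt.fun_mul hg.hasDerivWithinAt).derivWithin hI,
    Complex.cpow_sub _ _ ha_ne, Complex.cpow_one, Complex.cpow_neg]
  field_simp
  ring

end Operators

section Concomitants

/-- The bilinear concomitant of the kernel `besselRiesz ν (j + 1) x` and of `g` at `y`, for the
Bessel operator acting on `g`. -/
noncomputable def besselConcomitantRight (ν : ℂ) (I : Set ℝ) (g : ℝ → ℂ) (j : ℕ) (x y : ℝ) : ℂ :=
  besselRiesz ν (j + 1) x y * derivWithin g I y - besselTaylorRight ν (j + 1) x y * g y

/-- The bilinear concomitant of the kernel `besselRiesz ν (j + 1) · y` and of `g` at `x`, for the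
adjoint Bessel operator acting on `g`. -/
noncomputable def besselConcomitantLeft (ν : ℂ) (I : Set ℝ) (g : ℝ → ℂ) (j : ℕ) (x y : ℝ) : ℂ :=
  besselTaylorLeft ν (j + 1) x y * g x +
    besselRiesz ν (j + 1) x y * (derivWithin g I x - ν / x * g x)

variable {ν : ℂ} {I : Set ℝ} {g : ℝ → ℂ} {j k : ℕ} {x y : ℝ}

theorem hasDerivAt_besselConcomitantRight (hx : 0 < x) (hxy : x ≤ y) (hI : I ∈ 𝓝 y)
    (hg : DifferentiableWithinAt ℝ g I y)
    (hg' : DifferentiableWithinAt ℝ (derivWithin g I) I y) :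
    HasDerivAt (besselConcomitantRight ν I g j x)
      (besselRiesz ν (j + 1) x y * besselOp ν I g y - besselRiesz ν j x y * g y) y := by
  refine (((hasDerivAt_besselRiesz_right ν j hx hxy).mul (hg'.hasDerivWithinAt.hasDerivAt hI)).sub
    ((hasDerivAt_besselTaylorRight ν j hx hxy).mul
      (hg.hasDerivWithinAt.hasDerivAt hI))).congr_deriv ?_
  rw [besselOp]
  ring

theorem hasDerivAt_besselConcomitantLeft (hx : 0 < x) (hxy : x ≤ y) (hI : I ∈ 𝓝 x)
    (hg : DifferentiableWithinAt ℝ g I x)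
    (hg' : DifferentiableWithinAt ℝ (derivWithin g I) I x) :
    HasDerivAt (fun x ↦ besselConcomitantLeft ν I g j x y)
      (besselRiesz ν (j + 1) x y * besselAdjointOp ν I g x - besselRiesz ν j x y * g x) x := by
  have h_div : DifferentiableAt ℝ (fun x : ℝ ↦ ν / (x : ℂ)) x :=
    (differentiableAt_const ν).div (hasDerivAt_ofReal x).differentiableAt
      (Complex.ofReal_ne_zero.2 hx.ne')
  have h_mul := (h_div.differentiableWithinAt.fun_mul hg).hasDerivWithinAt.hasDerivAt hI
  refine (((hasDerivAt_besselTaylorLeft ν j hx hxy).fun_mul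
    (hg.hasDerivWithinAt.hasDerivAt hI)).fun_add ((hasDerivAt_besselRiesz_left ν j hx hxy).fun_mul
      ((hg'.hasDerivWithinAt.hasDerivAt hI).fun_sub h_mul))).congr_deriv ?_
  rw [besselAdjointOp]
  ring

theorem continuousOn_besselRiesz_right (hx : 0 < x) :
    ContinuousOn (besselRiesz ν j x) (Ici x) := by
  cases j with
  | zero => exact continuousOn_const.congr fun y _ ↦ besselRiesz_zero ν x y
  | succ j => exact fun y hy ↦
      (hasDerivAt_besselRiesz_right ν j hx hy).continuousAt.continuousWithinAt

theorem continuousOn_besselRiesz_left : ContinuousOn (besselRiesz ν j · y) (Ioc 0 y) := by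
  cases j with
  | zero => exact continuousOn_const.congr fun x _ ↦ besselRiesz_zero ν x y
  | succ j => exact fun x hx ↦
      (hasDerivAt_besselRiesz_left ν j hx.1 hx.2).continuousAt.continuousWithinAt

theorem continuousOn_besselConcomitantRight (hx : 0 < x) {s : Set ℝ} (hs : s ⊆ Ici x)
    (hg : ContinuousOn g s) (hg' : ContinuousOn (derivWithin g I) s) :
    ContinuousOn (besselConcomitantRight ν I g j x) s :=
  (((continuousOn_besselRiesz_right hx).mono hs).mul hg').sub <| ContinuousOn.mul
    (fun _ hy ↦ (hasDerivAt_besselTaylorRight ν j hx (hs hy)).continuousAt.continuousWithinAt) hg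

theorem continuousOn_besselConcomitantLeft {s : Set ℝ} (hs : s ⊆ Ioc 0 y) (hg : ContinuousOn g s)
    (hg' : ContinuousOn (derivWithin g I) s) :
    ContinuousOn (besselConcomitantLeft ν I g j · y) s := by
  have h_div : ContinuousOn (fun x : ℝ ↦ ν / (x : ℂ)) s :=
    (contDiffOn_const_div_ofReal (hs.trans Ioc_subset_Ioi_self) (n := 0)).continuousOn
  exact .add (.mul (fun x hx ↦ (hasDerivAt_besselTaylorLeft ν j (hs hx).1
    (hs hx).2).continuousAt.continuousWithinAt) hg)
    ((continuousOn_besselRiesz_left.mono hs).mul (hg'.sub (h_div.mul hg)))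

theorem sum_besselConcomitantRight_self (hk : 1 ≤ k) (G : ℕ → ℝ → ℂ) (x : ℝ) :
    ∑ j ∈ Finset.range k, besselConcomitantRight ν I (G j) j x x = -G 0 x := by
  rw [Finset.sum_eq_single_of_mem 0 (Finset.mem_range.2 hk)]
  · simp [besselConcomitantRight, besselRiesz_self, besselTaylorRight_one]
  · intro j _ hj
    obtain ⟨i, rfl⟩ := Nat.exists_eq_succ_of_ne_zero hj
    simp [besselConcomitantRight, besselRiesz_self, besselTaylorRight_add_two_self]

theorem sum_besselConcomitantLeft_self (hk : 1 ≤ k) (G : ℕ → ℝ → ℂ) (hx : x ≠ 0) :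
    ∑ j ∈ Finset.range k, besselConcomitantLeft ν I (G j) j x x = G 0 x := by
  rw [Finset.sum_eq_single_of_mem 0 (Finset.mem_range.2 hk)]
  · simp [besselConcomitantLeft, besselRiesz_self, besselTaylorLeft_one_self ν hx]
  · intro j _ hj
    obtain ⟨i, rfl⟩ := Nat.exists_eq_succ_of_ne_zero hj
    simp [besselConcomitantLeft, besselRiesz_self, besselTaylorLeft_add_two_self]

end Concomitants

section Taylor

variable {ν : ℂ} {k : ℕ} {I : Set ℝ} {f : ℝ → ℂ} {a b x : ℝ}

theorem intervalIntegrable_besselRiesz_mul_iterate_besselOp (hI : UniqueDiffOn ℝ I)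
    (hIpos : I ⊆ Ioi 0) (hf : ContDiffOn ℝ (2 * k : ℕ) f I) (hxb : x ≤ b) (h_sub : Icc x b ⊆ I) :
    IntervalIntegrable (fun y ↦ besselRiesz ν k x y * (besselOp ν I)^[k] f y) volume x b := by
  have h_op : ContDiffOn ℝ (0 : ℕ) ((besselOp ν I)^[k] f) I :=
    contDiffOn_iterate_of_order_two (contDiffOn_besselOp hI hIpos) k 0 (by rwa [zero_add])
  refine ContinuousOn.intervalIntegrable_of_Icc hxb ?_
  exact ((continuousOn_besselRiesz_right (hIpos (h_sub (left_mem_Icc.2 hxb)))).mono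
    Icc_subset_Ici_self).mul (h_op.continuousOn.mono h_sub)

theorem intervalIntegrable_besselRiesz_mul_iterate_besselAdjointOp (hI : UniqueDiffOn ℝ I)
    (hIpos : I ⊆ Ioi 0) (hf : ContDiffOn ℝ (2 * k : ℕ) f I) (hax : a ≤ x) (h_sub : Icc a x ⊆ I) :
    IntervalIntegrable (fun y ↦ besselRiesz ν k y x * (besselAdjointOp ν I)^[k] f y)
      volume a x := by
  have h_op : ContDiffOn ℝ (0 : ℕ) ((besselAdjointOp ν I)^[k] f) I :=
    contDiffOn_iterate_of_order_two (contDiffOn_besselAdjointOp hI hIpos) k 0 (by rwa [zero_add])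
  refine ContinuousOn.intervalIntegrable_of_Icc hax ?_
  exact (continuousOn_besselRiesz_left.mono fun y hy ↦ ⟨hIpos (h_sub hy), hy.2⟩).mul
    (h_op.continuousOn.mono h_sub)

theorem integral_besselRiesz_mul_iterate_besselOp (hI : UniqueDiffOn ℝ I) (hIpos : I ⊆ Ioi 0)
    (hf : ContDiffOn ℝ (2 * k : ℕ) f I) (hxb : x ≤ b) (h_sub : Icc x b ⊆ I) :
    ∫ y in x..b, besselRiesz ν k x y * (besselOp ν I)^[k] f y =
      ∑ j ∈ Finset.range k, (besselConcomitantRight ν I ((besselOp ν I)^[j] f) j x b -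
        besselConcomitantRight ν I ((besselOp ν I)^[j] f) j x x) := by
  have hx : 0 < x := hIpos (h_sub (left_mem_Icc.2 hxb))
  have h_reg (j : ℕ) (hj : j < k) : ContDiffOn ℝ (2 : ℕ) ((besselOp ν I)^[j] f) I :=
    contDiffOn_iterate_of_order_two (contDiffOn_besselOp hI hIpos) j 2
      (hf.of_le (by norm_cast; lia))
  have h_reg' (j : ℕ) (hj : j < k) :
      ContDiffOn ℝ (1 : ℕ) (derivWithin ((besselOp ν I)^[j] f) I) I :=
    (h_reg j hj).derivWithin hI le_rfl
  have h_telescope := integral_sub_eq_sum_of_hasDerivAt hxb (k := k)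
    (W := fun j ↦ besselConcomitantRight ν I ((besselOp ν I)^[j] f) j x)
    (u := fun j y ↦ besselRiesz ν j x y * (besselOp ν I)^[j] f y)
  simp only [besselRiesz_zero, zero_mul, sub_zero] at h_telescope
  refine h_telescope (fun j hj ↦ ?_) (fun j hj y hy ↦ ?_)
    (intervalIntegrable_besselRiesz_mul_iterate_besselOp hI hIpos hf hxb h_sub)
  · exact continuousOn_besselConcomitantRight hx Icc_subset_Ici_self
      ((h_reg j hj).continuousOn.mono h_sub) ((h_reg' j hj).continuousOn.mono h_sub)
  · have h_nhds : I ∈ 𝓝 y := Filter.mem_of_superset (Icc_mem_nhds hy.1 hy.2) h_sub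
    rw [Function.iterate_succ_apply']
    exact hasDerivAt_besselConcomitantRight hx hy.1.le h_nhds
      ((h_reg j hj).differentiableOn (by simp) y (mem_of_mem_nhds h_nhds))
      ((h_reg' j hj).differentiableOn (by simp) y (mem_of_mem_nhds h_nhds))

theorem integral_besselRiesz_mul_iterate_besselAdjointOp (hI : UniqueDiffOn ℝ I)
    (hIpos : I ⊆ Ioi 0) (hf : ContDiffOn ℝ (2 * k : ℕ) f I) (hax : a ≤ x) (h_sub : Icc a x ⊆ I) :
    ∫ y in a..x, besselRiesz ν k y x * (besselAdjointOp ν I)^[k] f y =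
      ∑ j ∈ Finset.range k, (besselConcomitantLeft ν I ((besselAdjointOp ν I)^[j] f) j x x -
        besselConcomitantLeft ν I ((besselAdjointOp ν I)^[j] f) j a x) := by
  have h_reg (j : ℕ) (hj : j < k) : ContDiffOn ℝ (2 : ℕ) ((besselAdjointOp ν I)^[j] f) I :=
    contDiffOn_iterate_of_order_two (contDiffOn_besselAdjointOp hI hIpos) j 2
      (hf.of_le (by norm_cast; lia))
  have h_reg' (j : ℕ) (hj : j < k) :
      ContDiffOn ℝ (1 : ℕ) (derivWithin ((besselAdjointOp ν I)^[j] f) I) I :=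
    (h_reg j hj).derivWithin hI le_rfl
  have h_telescope := integral_sub_eq_sum_of_hasDerivAt hax (k := k)
    (W := fun j y ↦ besselConcomitantLeft ν I ((besselAdjointOp ν I)^[j] f) j y x)
    (u := fun j y ↦ besselRiesz ν j y x * (besselAdjointOp ν I)^[j] f y)
  simp only [besselRiesz_zero, zero_mul, sub_zero] at h_telescope
  refine h_telescope (fun j hj ↦ ?_) (fun j hj y hy ↦ ?_)
    (intervalIntegrable_besselRiesz_mul_iterate_besselAdjointOp hI hIpos hf hax h_sub)
  · exact continuousOn_besselConcomitantLeft (fun y hy ↦ ⟨hIpos (h_sub hy), hy.2⟩)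
      ((h_reg j hj).continuousOn.mono h_sub) ((h_reg' j hj).continuousOn.mono h_sub)
  · have h_nhds : I ∈ 𝓝 y := Filter.mem_of_superset (Icc_mem_nhds hy.1 hy.2) h_sub
    rw [Function.iterate_succ_apply']
    exact hasDerivAt_besselConcomitantLeft (hIpos (mem_of_mem_nhds h_nhds)) hy.2.le h_nhds
      ((h_reg j hj).differentiableOn (by simp) y (mem_of_mem_nhds h_nhds))
      ((h_reg' j hj).differentiableOn (by simp) y (mem_of_mem_nhds h_nhds))

theorem besselIntegralRight_eq_integral_besselRiesz (g : ℝ → ℂ) :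
    besselIntegralRight ν k b g x = ∫ y in x..b, besselRiesz ν k x y * g y := by
  simp only [besselIntegralRight, besselKernelRight, besselRiesz, mul_assoc,
    intervalIntegral.integral_const_mul]

theorem besselIntegralLeft_eq_integral_besselRiesz (g : ℝ → ℂ) :
    besselIntegralLeft ν k a g x = ∫ y in a..x, besselRiesz ν k y x * g y := by
  simp only [besselIntegralLeft, besselKernelLeft, besselRiesz, mul_assoc,
    intervalIntegral.integral_const_mul]

theorem besselKernelRight_eq_Gamma_mul_besselRiesz (hk : 1 ≤ k) (x y : ℝ) :
    besselKernelRight ν k x y = Complex.Gamma (2 * k) * besselRiesz ν k x y := by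
  have h_Gamma : Complex.Gamma (2 * k) ≠ 0 :=
    Complex.Gamma_ne_zero_of_re_pos (by simpa using Nat.zero_lt_of_lt hk)
  rw [besselKernelRight, besselRiesz]
  field_simp

theorem besselKernelLeft_eq_Gamma_mul_besselRiesz (hk : 1 ≤ k) (x y : ℝ) :
    besselKernelLeft ν k y x = Complex.Gamma (2 * k) * besselRiesz ν k x y := by
  have h_Gamma : Complex.Gamma (2 * k) ≠ 0 :=
    Complex.Gamma_ne_zero_of_re_pos (by simpa using Nat.zero_lt_of_lt hk)
  rw [besselKernelLeft, besselRiesz]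
  field_simp

theorem eq_sum_add_besselIntegralRight (hI : UniqueDiffOn ℝ I) (hIpos : I ⊆ Ioi 0) (hk : 1 ≤ k)
    (hf : ContDiffOn ℝ (2 * k : ℕ) f I) (hxb : x ≤ b) (h_sub : Icc x b ⊆ I) :
    f x = ∑ i ∈ Finset.Icc 1 k, (besselTaylorRight ν i x b * (besselOp ν I)^[i - 1] f b -
        besselRiesz ν i x b * derivWithin ((besselOp ν I)^[i - 1] f) I b) +
      besselIntegralRight ν k b ((besselOp ν I)^[k] f) x := by
  have h_terms : ∑ i ∈ Finset.Icc 1 k, (besselTaylorRight ν i x b * (besselOp ν I)^[i - 1] f b -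
        besselRiesz ν i x b * derivWithin ((besselOp ν I)^[i - 1] f) I b) =
      -∑ j ∈ Finset.range k, besselConcomitantRight ν I ((besselOp ν I)^[j] f) j x b := by
    simp [sum_Icc_one_eq_sum_range, besselConcomitantRight]
  rw [h_terms, besselIntegralRight_eq_integral_besselRiesz,
    integral_besselRiesz_mul_iterate_besselOp hI hIpos hf hxb h_sub, Finset.sum_sub_distrib,
    sum_besselConcomitantRight_self hk, sub_neg_eq_add, neg_add_cancel_left,
    Function.iterate_zero_apply]

theorem eq_sum_add_besselIntegralLeft (hI : UniqueDiffOn ℝ I) (hIpos : I ⊆ Ioi 0) (hk : 1 ≤ k)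
    (hf : ContDiffOn ℝ (2 * k : ℕ) f I) (hax : a ≤ x) (h_sub : Icc a x ⊆ I) :
    f x = ∑ i ∈ Finset.Icc 1 k, (besselTaylorLeft ν i a x * (besselAdjointOp ν I)^[i - 1] f a +
        besselRiesz ν i a x * (a : ℂ) ^ ν *
          derivWithin (fun y : ℝ ↦ (y : ℂ) ^ (-ν) * (besselAdjointOp ν I)^[i - 1] f y) I a) +
      besselIntegralLeft ν k a ((besselAdjointOp ν I)^[k] f) x := by
  have ha : a ∈ I := h_sub (left_mem_Icc.2 hax)
  have hx : 0 < x := (hIpos ha).trans_le hax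
  have h_terms : ∑ i ∈ Finset.Icc 1 k,
      (besselTaylorLeft ν i a x * (besselAdjointOp ν I)^[i - 1] f a +
        besselRiesz ν i a x * (a : ℂ) ^ ν *
          derivWithin (fun y : ℝ ↦ (y : ℂ) ^ (-ν) * (besselAdjointOp ν I)^[i - 1] f y) I a) =
      ∑ j ∈ Finset.range k, besselConcomitantLeft ν I ((besselAdjointOp ν I)^[j] f) j a x := by
    rw [sum_Icc_one_eq_sum_range]
    refine Finset.sum_congr rfl fun j hj ↦ ?_
    have h_reg : ContDiffOn ℝ (1 : ℕ) ((besselAdjointOp ν I)^[j] f) I :=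
      contDiffOn_iterate_of_order_two (contDiffOn_besselAdjointOp hI hIpos) j 1
        (hf.of_le (by have := Finset.mem_range.1 hj; norm_cast; lia))
    rw [mul_assoc, Nat.add_sub_cancel, cpow_mul_derivWithin_cpow_neg_mul (hIpos ha) (hI a ha)
      (h_reg.differentiableOn (by simp) a ha), besselConcomitantLeft]
  rw [h_terms, besselIntegralLeft_eq_integral_besselRiesz,
    integral_besselRiesz_mul_iterate_besselAdjointOp hI hIpos hf hax h_sub, Finset.sum_sub_distrib,
    sum_besselConcomitantLeft_self hk _ hx.ne', add_sub_cancel, Function.iterate_zero_apply]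

end Taylor

theorem theorem7_general (ν : ℂ) (k : ℕ) (hk : 1 ≤ k)
    (I : Set ℝ) (hI : I.OrdConnected) (hIpos : I ⊆ Set.Ioi 0) (hInt : I.Nontrivial)
    (f : ℝ → ℂ) (hf : ContDiffOn ℝ ((2 * k : ℕ) : WithTop ℕ∞) f I) :
    (∀ b ∈ I, ∀ x ∈ I, x ≤ b →
      IntervalIntegrable (fun y ↦ besselKernelRight ν k x y * (besselOp ν I)^[k] f y)
        volume x b ∧
      f x = ∑ i ∈ Finset.Icc 1 k, (besselTaylorRight ν i x b * (besselOp ν I)^[i - 1] f b -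
          besselRiesz ν i x b * derivWithin ((besselOp ν I)^[i - 1] f) I b) +
        besselIntegralRight ν k b ((besselOp ν I)^[k] f) x) ∧
    (∀ a ∈ I, ∀ x ∈ I, a ≤ x →
      IntervalIntegrable (fun y ↦ besselKernelLeft ν k x y * (besselAdjointOp ν I)^[k] f y)
        volume a x ∧
      f x = ∑ i ∈ Finset.Icc 1 k, (besselTaylorLeft ν i a x * (besselAdjointOp ν I)^[i - 1] f a +
          besselRiesz ν i a x * (a : ℂ) ^ ν *
            derivWithin (fun y : ℝ ↦ (y : ℂ) ^ (-ν) * (besselAdjointOp ν I)^[i - 1] f y) I a) +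
        besselIntegralLeft ν k a ((besselAdjointOp ν I)^[k] f) x) := by
  have hU := uniqueDiffOn_of_ordConnected_nontrivial hI hInt
  refine ⟨fun b hb x hx hxb ↦ ⟨?_, ?_⟩, fun a ha x hx hax ↦ ⟨?_, ?_⟩⟩
  · simp only [besselKernelRight_eq_Gamma_mul_besselRiesz hk, mul_assoc]
    exact (intervalIntegrable_besselRiesz_mul_iterate_besselOp hU hIpos hf hxb
      (hI.out hx hb)).const_mul _
  · exact eq_sum_add_besselIntegralRight hU hIpos hk hf hxb (hI.out hx hb)
  · simp only [besselKernelLeft_eq_Gamma_mul_besselRiesz hk, mul_assoc]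
    exact (intervalIntegrable_besselRiesz_mul_iterate_besselAdjointOp hU hIpos hf hax
      (hI.out ha hx)).const_mul _
  · exact eq_sum_add_besselIntegralLeft hU hIpos hk hf hax (hI.out ha hx)

theorem theorem7 (ν : ℂ) (hν : 0 ≤ ν.re) (k : ℕ) (hk : 1 ≤ k)
    (I : Set ℝ) (hI : I.OrdConnected) (hIpos : I ⊆ Set.Ioi 0) (hInt : I.Nontrivial)
    (f : ℝ → ℂ) (hf : ContDiffOn ℝ ((2 * k : ℕ) : WithTop ℕ∞) f I) :
    (∀ b ∈ I, ∀ x ∈ I, x ≤ b →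
      IntervalIntegrable (fun y => besselKernelRight ν k x y * (besselOp ν I)^[k] f y)
        volume x b ∧
      f x = ∑ i ∈ Finset.Icc 1 k,
          (1 / Complex.Gamma (2 * (i : ℂ) - 1) *
              (((b : ℂ) ^ 2 - (x : ℂ) ^ 2) / (2 * (b : ℂ))) ^ (2 * i - 2) *
              ordinaryHypergeometric ((i : ℂ) + (ν - 1) / 2) ((i : ℂ) - 1) (2 * (i : ℂ) - 1)
                (1 - (x : ℂ) ^ 2 / (b : ℂ) ^ 2) *
              (besselOp ν I)^[i - 1] f b
            - 1 / Complex.Gamma (2 * (i : ℂ)) *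
              (((b : ℂ) ^ 2 - (x : ℂ) ^ 2) / (2 * (b : ℂ))) ^ (2 * i - 1) *
              ordinaryHypergeometric ((i : ℂ) + (ν - 1) / 2) (i : ℂ) (2 * (i : ℂ))
                (1 - (x : ℂ) ^ 2 / (b : ℂ) ^ 2) *
              derivWithin ((besselOp ν I)^[i - 1] f) I b)
        + besselIntegralRight ν k b ((besselOp ν I)^[k] f) x) ∧
    (∀ a ∈ I, ∀ x ∈ I, a ≤ x →
      IntervalIntegrable (fun y => besselKernelLeft ν k x y * (besselAdjointOp ν I)^[k] f y)
        volume a x ∧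
      f x = ∑ i ∈ Finset.Icc 1 k,
          (1 / Complex.Gamma (2 * (i : ℂ) - 1) *
              (((x : ℂ) ^ 2 - (a : ℂ) ^ 2) / (2 * (x : ℂ))) ^ (2 * i - 2) *
              ((a : ℂ) / (x : ℂ)) *
              ordinaryHypergeometric ((i : ℂ) + (ν - 1) / 2) (i : ℂ) (2 * (i : ℂ) - 1)
                (1 - (a : ℂ) ^ 2 / (x : ℂ) ^ 2) *
              (besselAdjointOp ν I)^[i - 1] f a
            + 1 / Complex.Gamma (2 * (i : ℂ)) *
              (((x : ℂ) ^ 2 - (a : ℂ) ^ 2) / (2 * (x : ℂ))) ^ (2 * i - 1) *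
              ordinaryHypergeometric ((i : ℂ) + (ν - 1) / 2) (i : ℂ) (2 * (i : ℂ))
                (1 - (a : ℂ) ^ 2 / (x : ℂ) ^ 2) *
              (a : ℂ) ^ ν *
              derivWithin (fun y : ℝ => (y : ℂ) ^ (-ν) * (besselAdjointOp ν I)^[i - 1] f y) I a)
        + besselIntegralLeft ν k a ((besselAdjointOp ν I)^[k] f) x) :=
  theorem7_general ν k hk I hI hIpos hInt f hf
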